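/- An asymptotic couple $(\Gamma,\psi)$ is an ordered abelian group $\Gamma$ with a map $\psi:\Gamma\setminus\{0\}\to\Gamma$ such that for all nonzero $\alpha,\beta\in\Gamma$: $\psi(\alpha+\beta)\ge\min(\psi(\alpha),\psi(\beta))$ if $\alpha+\beta\ne 0$; $\psi(r\alpha)=\psi(\alpha)$ for all nonzero $r\in\mathbb Z$; and $\alpha+\psi(\alpha)>\psi(\beta)$ if $\alpha>0$. It is of $H$-type if $0<\alpha\le\beta$ implies $\psi(\alpha)\ge\psi(\beta)$, and it has asymptotic integration if every $\alpha\in\Gamma$ has the form $\alpha=\gamma+\psi(\gamma)$ with $\gamma\neq 0$; this $\gamma$ is then unique, and we put $s(\alpha):=\psi(\gamma)$. Let $\Psi:=\psi(\Gamma\setminus\{0\})$. A model of $T_{\log}$ is an asymptotic couple $(\Gamma,\psi)$ of $H$-type with asymptotic integration such that $\Gamma$ is divisible, $s(0)>0$ is the least element of $\Psi$, every $\alpha\in\Psi$ has immediate successor $s(\alpha)$ in $\Psi$, and $s$ restricts to a bijection $\Psi\to\Psi^{>s(0)}:=\{\alpha\in\Psi:\alpha>s(0)\}$. It is regarded as a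 first-order structure with underlying set $\Gamma_\infty=\Gamma\cup\{\infty\}$, where $\infty>\Gamma$, in the language $\{0,+,-,<,\psi,\infty,s,p,\delta_1,\delta_2,\dots\}$; here $\psi(0)=\infty$, $p$ is the inverse of $s:\Psi\to\Psi^{>s(0)}$ on $\Psi^{>s(0)}$ and takes the value $\infty$ elsewhere, $\delta_n$ is division by $n$, and every function takes the value $\infty$ when an argument is $\infty$. "Definable" means definable in this structure with parameters from $\Gamma_\infty$. As a divisible ordered abelian group, $\Gamma$ is a $\mathbb Q$-vector space. **Lemma ("o-minimal at infinity").** Let $(\Gamma,\psi)$ be a model of $T_{\log}$. 1. If $X\subseteq\Gamma$ is definable, then there is $a\in\Gamma$ such that $(a,\infty)\subseteq X$ or $(a,\infty)\cap X=\emptyset$, where $(a,\infty)=\{x\in\Gamma: x>a\}$. 2. If $F:\Gamma\to\Gamma_\infty$ is definable, then there is $a\in\Gamma$ such that on $(a,\infty)$ the function $F$ is either constant (with value in $\Gamma_\infty$) or of the form $x\mapsto qx+\beta$ for some $q\in\mathbb Q\setminus\{0\}$ and $\beta\in\Gamma$. -/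

import Mathlib

namespace AsymptoticCouple

section Couples

variable {Γ : Type*} [AddCommGroup Γ] [LinearOrder Γ] [IsOrderedAddMonoid Γ]

/-- `(Γ, ψ)` is an asymptotic couple, where `ψ` maps the nonzero elements of the ordered abelian
group `Γ` into `Γ`. -/
structure IsAsymptoticCouple (ψ : {a : Γ // a ≠ 0} → Γ) : Prop where
  ac1 : ∀ (a b : Γ) (ha : a ≠ 0) (hb : b ≠ 0) (hab : a + b ≠ 0),
    min (ψ ⟨a, ha⟩) (ψ ⟨b, hb⟩) ≤ ψ ⟨a + b, hab⟩
  ac2 : ∀ (a : Γ) (ha : a ≠ 0) (r : ℤ) (hr : r ≠ 0),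
    ψ ⟨r • a, smul_ne_zero hr ha⟩ = ψ ⟨a, ha⟩
  ac3 : ∀ (a b : Γ) (ha : 0 < a) (hb : b ≠ 0), ψ ⟨b, hb⟩ < a + ψ ⟨a, ha.ne'⟩

/-- An asymptotic couple of `H`-type. -/
structure IsHAsymptoticCouple (ψ : {a : Γ // a ≠ 0} → Γ) : Prop extends
    IsAsymptoticCouple ψ where
  hc : ∀ (a b : Γ) (ha : 0 < a) (hab : a ≤ b),
    ψ ⟨b, (ha.trans_le hab).ne'⟩ ≤ ψ ⟨a, ha.ne'⟩

/-- The map `γ ↦ γ' = γ + ψ(γ)` on nonzero elements. -/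
def der (ψ : {a : Γ // a ≠ 0} → Γ) (γ : {a : Γ // a ≠ 0}) : Γ := γ.1 + ψ γ

/-- The set `Ψ = ψ(Γ ∖ {0})`. -/
def PsiSet (ψ : {a : Γ // a ≠ 0} → Γ) : Set Γ := Set.range ψ

/-- Asymptotic integration: every element of `Γ` is of the form `γ'` with `γ ≠ 0`. -/
def HasAsymptoticIntegration (ψ : {a : Γ // a ≠ 0} → Γ) : Prop :=
  Function.Surjective (der ψ)

/-- The map `γ ↦ γ'` of an asymptotic couple is injective, so integrals are unique. -/
theorem IsAsymptoticCouple.der_injective {ψ : {a : Γ // a ≠ 0} → Γ}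
    (h : IsAsymptoticCouple ψ) : Function.Injective (der ψ) := by
  have key : ∀ x y : {a : Γ // a ≠ 0}, der ψ x = der ψ y → ¬ y.1 < x.1 := by
    rintro ⟨x, hx⟩ ⟨y, hy⟩ hxy hlt
    simp only [der] at hxy hlt
    have hpos : 0 < x - y := sub_pos.2 hlt
    have h3 := h.ac3 (x - y) y hpos hy
    have hd : x - y = ψ ⟨y, hy⟩ - ψ ⟨x, hx⟩ := by
      rw [sub_eq_sub_iff_add_eq_add, hxy, add_comm]
    have h1 := h.ac1 (x - y) y hpos.ne' hy (by simpa using hx)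
    simp only [sub_add_cancel] at h1
    have hlt' : ψ ⟨x, hx⟩ < ψ ⟨y, hy⟩ := by rw [hd] at hpos; exact sub_pos.1 hpos
    rcases min_le_iff.1 h1 with h1 | h1
    · have h4 : x - y + ψ ⟨x - y, hpos.ne'⟩ ≤ (x - y) + ψ ⟨x, hx⟩ := by gcongr
      have h5 : (x - y) + ψ ⟨x, hx⟩ = ψ ⟨y, hy⟩ := by rw [hd, sub_add_cancel]
      exact absurd (h3.trans_le (h4.trans h5.le)) (lt_irrefl _)
    · exact absurd (hlt'.trans_le h1) (lt_irrefl _)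
  intro x y hxy
  exact Subtype.ext (le_antisymm (not_lt.1 (key x y hxy)) (not_lt.1 (key y x hxy.symm)))

/-- The integral `∫ a`: the element `b ≠ 0` with `b' = a`. -/
noncomputable def integral {ψ : {a : Γ // a ≠ 0} → Γ} (h : HasAsymptoticIntegration ψ) (a : Γ) :
    {b : Γ // b ≠ 0} := Classical.choose (h a)

theorem der_integral {ψ : {a : Γ // a ≠ 0} → Γ} (h : HasAsymptoticIntegration ψ) (a : Γ) :
    der ψ (integral h a) = a := Classical.choose_spec (h a)

/-- The successor function `s(a) = ψ(∫ a)`. -/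
noncomputable def s {ψ : {a : Γ // a ≠ 0} → Γ} (h : HasAsymptoticIntegration ψ) (a : Γ) : Γ :=
  ψ (integral h a)

/-- `(Γ, ψ)` is a model of `T_log`: a divisible `H`-asymptotic couple with asymptotic integration
such that `Ψ` has least element `s 0 > 0`, every `a ∈ Ψ` has immediate successor `s a` in `Ψ`, and
`s` restricts to a bijection from `Ψ` onto `Ψ^{> s 0}`. -/
structure IsTLogModel (ψ : {a : Γ // a ≠ 0} → Γ) : Prop extends IsHAsymptoticCouple ψ where
  divisible : ∀ (n : ℕ+) (a : Γ), ∃ b : Γ, (n : ℕ) • b = a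
  integration : HasAsymptoticIntegration ψ
  s_zero_pos : 0 < s integration 0
  s_zero_least : IsLeast (PsiSet ψ) (s integration 0)
  s_successor : ∀ a ∈ PsiSet ψ, s integration a ∈ PsiSet ψ ∧ a < s integration a ∧
    ∀ z ∈ PsiSet ψ, a < z → s integration a ≤ z
  s_bijOn : Set.BijOn (s integration) (PsiSet ψ) {x | x ∈ PsiSet ψ ∧ s integration 0 < x}

/-- Division by `n ≥ 1` in `Γ`. -/
noncomputable def divNat {ψ : {a : Γ // a ≠ 0} → Γ} (h : IsTLogModel ψ) (n : ℕ+) (a : Γ) : Γ :=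
  Classical.choose (h.divisible n a)

theorem nsmul_divNat {ψ : {a : Γ // a ≠ 0} → Γ} (h : IsTLogModel ψ) (n : ℕ+) (a : Γ) :
    (n : ℕ) • divNat h n a = a := Classical.choose_spec (h.divisible n a)

/-- The scalar multiplication of `ℚ` on the divisible torsion-free group `Γ`. -/
noncomputable def ratMul {ψ : {a : Γ // a ≠ 0} → Γ} (h : IsTLogModel ψ) (q : ℚ) (a : Γ) : Γ :=
  q.num • divNat h ⟨q.den, q.den_pos⟩ a

/-- `ratMul h q a` is the (unique) solution `b` of `den(q) b = num(q) a`. -/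
theorem den_nsmul_ratMul {ψ : {a : Γ // a ≠ 0} → Γ} (h : IsTLogModel ψ) (q : ℚ) (a : Γ) :
    q.den • ratMul h q a = q.num • a := by
  have := nsmul_divNat h ⟨q.den, q.den_pos⟩ a
  simp only [PNat.mk_coe] at this
  rw [ratMul, smul_comm, this]

end Couples

/-- Function symbols `0, ∞, +, -, ψ, s, p, δ₁, δ₂, …`. -/
inductive LogFunc : ℕ → Type
  | zero : LogFunc 0
  | infty : LogFunc 0
  | add : LogFunc 2
  | neg : LogFunc 1
  | psi : LogFunc 1
  | succ : LogFunc 1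
  | pred : LogFunc 1
  | div (n : ℕ+) : LogFunc 1

/-- The only relation symbol is `<`. -/
inductive LogRel : ℕ → Type
  | lt : LogRel 2

/-- The first-order language `{0, +, -, <, ψ, ∞, s, p, δ₁, δ₂, …}` of `T_log`. -/
def logLanguage : FirstOrder.Language where
  Functions := LogFunc
  Relations := LogRel

section Interpretation

variable {Γ : Type*} [AddCommGroup Γ] [LinearOrder Γ] [IsOrderedAddMonoid Γ]

/-- Extend a function `Γ → Γ_∞` to `Γ_∞` by sending `∞` to `∞`. -/
def extendTop (f : Γ → WithTop Γ) : WithTop Γ → WithTop Γ :=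
  WithTop.recTopCoe ⊤ f

/-- `ψ` with the convention `ψ(0) = ∞`. -/
noncomputable def psiTop (ψ : {a : Γ // a ≠ 0} → Γ) (a : Γ) : WithTop Γ :=
  open Classical in if ha : a ≠ 0 then ((ψ ⟨a, ha⟩ : Γ) : WithTop Γ) else ⊤

/-- The function `p`: the inverse of `s : Ψ → Ψ^{> s 0}` on `Ψ^{> s 0}`, and `∞` elsewhere. -/
noncomputable def pTop {ψ : {a : Γ // a ≠ 0} → Γ} (h : IsTLogModel ψ) (a : Γ) : WithTop Γ :=
  open Classical in
  if a ∈ PsiSet ψ ∧ s h.integration 0 < a then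
    (Function.invFunOn (s h.integration) (PsiSet ψ) a : Γ)
  else ⊤

/-- The interpretation of the function symbols in `Γ_∞ = WithTop Γ`; every function takes the
default value `∞` as soon as one of its arguments is `∞`. -/
noncomputable def interpFunc {ψ : {a : Γ // a ≠ 0} → Γ} (h : IsTLogModel ψ) :
    ∀ {n : ℕ}, LogFunc n → (Fin n → WithTop Γ) → WithTop Γ
  | _, .zero, _ => ((0 : Γ) : WithTop Γ)
  | _, .infty, _ => ⊤
  | _, .add, v => v 0 + v 1
  | _, .neg, v => extendTop (fun a => ((-a : Γ) : WithTop Γ)) (v 0)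
  | _, .psi, v => extendTop (psiTop ψ) (v 0)
  | _, .succ, v => extendTop (fun a => ((s h.integration a : Γ) : WithTop Γ)) (v 0)
  | _, .pred, v => extendTop (pTop h) (v 0)
  | _, .div n, v => extendTop (fun a => ((divNat h n a : Γ) : WithTop Γ)) (v 0)

/-- The interpretation of `<`, with `γ < ∞` for all `γ ∈ Γ`. -/
def interpRel : ∀ {n : ℕ}, LogRel n → (Fin n → WithTop Γ) → Prop
  | _, .lt, v => v 0 < v 1

/-- A model `(Γ, ψ)` of `T_log` as a first-order structure with underlying set `Γ_∞`. -/
@[reducible] noncomputable def logStructure {ψ : {a : Γ // a ≠ 0} → Γ} (h : IsTLogModel ψ) :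
    logLanguage.Structure (WithTop Γ) where
  funMap := fun f v => interpFunc h f v
  RelMap := fun r v => interpRel r v

/-- `X ⊆ Γ` is definable (with parameters) in `(Γ, ψ)`, as a subset of `Γ_∞`. -/
def IsDefinableSet {ψ : {a : Γ // a ≠ 0} → Γ} (h : IsTLogModel ψ) (X : Set Γ) : Prop :=
  letI := logStructure h
  (Set.univ : Set (WithTop Γ)).Definable₁ logLanguage
    ((fun a : Γ => (a : WithTop Γ)) '' X)

/-- `F : Γ → Γ_∞` is definable (with parameters) in `(Γ, ψ)`: its graph, a subset of `Γ_∞ × Γ_∞`,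
is definable. -/
def IsDefinableFun {ψ : {a : Γ // a ≠ 0} → Γ} (h : IsTLogModel ψ) (F : Γ → WithTop Γ) : Prop :=
  letI := logStructure h
  (Set.univ : Set (WithTop Γ)).Definable₂ logLanguage
    (Set.range fun a : Γ => ((a : WithTop Γ), F a))

end Interpretation

end AsymptoticCouple

set_option linter.unusedSectionVars false

namespace AsymptoticCouple

/-! ### Scalar multiplication by rationals -/

section RationalScalars

variable {Γ : Type*} [AddCommGroup Γ] [LinearOrder Γ] [IsOrderedAddMonoid Γ]
  {ψ : {a : Γ // a ≠ 0} → Γ}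

/-! Let Δ be the convex ℚ-subspace of all a with a = 0 or ψ(a) > s(0) (`smallElements`). Everything
nonlinear happens near two cosets of Δ: ψ is constantly s(0) off Δ, while off s(0) + Δ the function
s is constantly s(0) and p is constantly ∞. Moreover the finite values of ψ, s, p lie in s(0) + Δ.
Hence a term is, up to an element of Δ, one of finitely many ℚ-affine forms.

Call two elements similar (`Sim`) if they are equal elements of Δ or lie on the same side of Δ. For
every formula there are finitely many affine forms such that tuples with the same infinite entries
and similar values of these forms satisfy it alike (`exists_tupleSim_realize`). The quantifier step
eliminates one variable from a finite family of forms, as in Fourier–Motzkin elimination, modulo Δ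
(`exists_sim_affine`). No quantifier elimination for the theory is needed.

A form qx + b with q ≠ 0 is eventually on one side of Δ, which gives the statement about sets. For a
function F, all pairs (x, F x) with x large are similar. If F x is finite, some form involving the
second variable takes a value in Δ there, since otherwise F x could be shifted by a nonzero element
of Δ. Similarity makes this value independent of x, and solving for F x gives an affine function. -/

theorem zsmul_ratMul (h : IsTLogModel ψ) {q : ℚ} {m n : ℤ} (hq : q * n = m) (a : Γ) :
    n • ratMul h q a = m • a := by
  have hden : (q.den : ℤ) ≠ 0 := by exact_mod_cast q.den_ne_zero
  have hmn : n * q.num = m * q.den := by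
    have h1 : (q.num : ℚ) = q * q.den := (Rat.mul_den_eq_num q).symm
    have h2 : ((n * q.num : ℤ) : ℚ) = ((m * q.den : ℤ) : ℚ) := by
      push_cast
      rw [h1, ← hq]
      ring
    exact_mod_cast h2
  apply zsmul_right_injective hden
  have h3 := den_nsmul_ratMul h q a
  rw [← natCast_zsmul] at h3
  simp only
  rw [smul_comm, h3, smul_smul, hmn, smul_smul, mul_comm]

/-- Torsion-freeness lets b be recognized after clearing denominators; the vector space axioms are
all checked this way. -/
theorem eq_ratMul (h : IsTLogModel ψ) {q : ℚ} {m n : ℤ} (hn : n ≠ 0) (hq : q * n = m) {a b : Γ}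
    (hb : n • b = m • a) : b = ratMul h q a :=
  zsmul_right_injective hn (hb.trans (zsmul_ratMul h hq a).symm)

/-- A model of `T_log` is a vector space over `ℚ`. -/
@[reducible] noncomputable def ratModule (h : IsTLogModel ψ) : Module ℚ Γ where
  smul := ratMul h
  one_smul a := (eq_ratMul h (m := 1) (n := 1) one_ne_zero (by norm_num) rfl).symm
  mul_smul p q a := by
    refine (eq_ratMul h (m := p.num * q.num) (n := p.den * q.den) ?_ ?_ ?_).symm
    · exact_mod_cast mul_ne_zero p.den_ne_zero q.den_ne_zero
    · push_cast
      rw [← Rat.mul_den_eq_num p, ← Rat.mul_den_eq_num q]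
      ring
    · change ((p.den : ℤ) * q.den) • ratMul h p (ratMul h q a) = _
      rw [mul_comm, mul_smul, zsmul_ratMul h (m := p.num) (by exact_mod_cast Rat.mul_den_eq_num p),
        smul_comm, zsmul_ratMul h (m := q.num) (by exact_mod_cast Rat.mul_den_eq_num q), mul_smul]
  smul_zero q := (eq_ratMul h (m := q.num) (n := q.den)
    (by exact_mod_cast q.den_ne_zero) (by exact_mod_cast Rat.mul_den_eq_num q) (by simp)).symm
  smul_add q a b := by
    have hq : q * (q.den : ℤ) = q.num := by exact_mod_cast Rat.mul_den_eq_num q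
    refine (eq_ratMul h (m := q.num) (n := q.den) (by exact_mod_cast q.den_ne_zero) hq ?_).symm
    change (q.den : ℤ) • (ratMul h q a + ratMul h q b) = _
    rw [smul_add, zsmul_ratMul h hq, zsmul_ratMul h hq, smul_add]
  add_smul p q a := by
    refine (eq_ratMul h (m := p.num * q.den + q.num * p.den) (n := p.den * q.den) ?_ ?_ ?_).symm
    · exact_mod_cast mul_ne_zero p.den_ne_zero q.den_ne_zero
    · push_cast
      rw [← Rat.mul_den_eq_num p, ← Rat.mul_den_eq_num q]
      ring
    · change ((p.den : ℤ) * q.den) • (ratMul h p a + ratMul h q a) = _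
      rw [smul_add, add_smul, zsmul_ratMul h (q := p) (m := p.num * q.den),
        zsmul_ratMul h (q := q) (m := q.num * p.den)]
      · push_cast
        rw [← Rat.mul_den_eq_num q]
        ring
      · push_cast
        rw [← Rat.mul_den_eq_num p]
        ring
  zero_smul a := (eq_ratMul h (m := 0) (n := 1) one_ne_zero (by norm_num) (by simp)).symm

end RationalScalars

/-! ### Similarity modulo a convex subspace, and elimination of a variable -/

section ConvexSubspace

variable {Γ : Type*} [AddCommGroup Γ] [LinearOrder Γ] [IsOrderedAddMonoid Γ] [Module ℚ Γ]

theorem rat_smul_pos {q : ℚ} (hq : 0 < q) {a : Γ} (ha : 0 < a) : 0 < q • a := by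
  have h1 : q.den • (q • a) = q.num • a := by
    rw [← Nat.cast_smul_eq_nsmul ℚ, ← Int.cast_smul_eq_zsmul ℚ, smul_smul, mul_comm,
      Rat.mul_den_eq_num]
  by_contra hle
  have h2 := nsmul_nonpos (not_lt.1 hle) q.den
  rw [h1] at h2
  exact h2.not_gt (zsmul_pos ha (Rat.num_pos.2 hq))

/-- `a` is positive and not in the subspace `Δ`. -/
def Above (Δ : Submodule ℚ Γ) (a : Γ) : Prop := a ∉ Δ ∧ 0 < a

/-- `a` and `b` are equal elements of `Δ`, or both lie above `Δ`, or both lie below `Δ`. -/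
def Sim (Δ : Submodule ℚ Γ) (a b : Γ) : Prop :=
  (a ∈ Δ ∧ a = b) ∨ (Above Δ a ∧ Above Δ b) ∨ (Above Δ (-a) ∧ Above Δ (-b))

/-- Convexity of the subspace `Δ`. -/
def IsConvex (Δ : Submodule ℚ Γ) : Prop := ∀ a b : Γ, 0 ≤ a → a ≤ b → b ∈ Δ → a ∈ Δ

variable {Δ : Submodule ℚ Γ}

theorem Above.mono (hΔ : IsConvex Δ) {a b : Γ} (ha : Above Δ a) (hab : a ≤ b) : Above Δ b :=
  ⟨fun hb => ha.1 (hΔ a b ha.2.le hab hb), ha.2.trans_le hab⟩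

theorem Above.smul {a : Γ} (ha : Above Δ a) {q : ℚ} (hq : 0 < q) : Above Δ (q • a) :=
  ⟨fun h => ha.1 ((Δ.smul_mem_iff hq.ne').1 h), rat_smul_pos hq ha.2⟩

/-- If a + δ ≤ 0, then 0 < a ≤ -δ, and convexity would put a in Δ. -/
theorem Above.add_mem (hΔ : IsConvex Δ) {a δ : Γ} (ha : Above Δ a) (hδ : δ ∈ Δ) :
    Above Δ (a + δ) := by
  refine ⟨fun h => ha.1 ((Δ.add_mem_iff_left hδ).1 h), ?_⟩
  by_contra hle
  exact ha.1 (hΔ a (-δ) ha.2.le (by rw [le_neg_iff_add_nonpos_right]; exact not_lt.1 hle)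
    (Δ.neg_mem hδ))

theorem mem_or_above (Δ : Submodule ℚ Γ) (a : Γ) : a ∈ Δ ∨ Above Δ a ∨ Above Δ (-a) := by
  by_cases h : a ∈ Δ
  · exact Or.inl h
  · rcases lt_trichotomy a 0 with h0 | h0 | h0
    · exact Or.inr (Or.inr ⟨fun hn => h (by simpa using hn), neg_pos.2 h0⟩)
    · exact absurd (h0 ▸ Δ.zero_mem) h
    · exact Or.inr (Or.inl ⟨h, h0⟩)

theorem Above.not_mem_of_neg {a : Γ} (h : Above Δ (-a)) : a ∉ Δ :=
  fun ha => h.1 (Δ.neg_mem ha)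

theorem Above.not_above_neg {a : Γ} (h : Above Δ a) : ¬ Above Δ (-a) :=
  fun h' => lt_asymm h.2 (neg_pos.1 h'.2)

namespace Sim

theorem refl (Δ : Submodule ℚ Γ) (a : Γ) : Sim Δ a a := by
  rcases mem_or_above Δ a with h | h | h
  · exact Or.inl ⟨h, rfl⟩
  · exact Or.inr (Or.inl ⟨h, h⟩)
  · exact Or.inr (Or.inr ⟨h, h⟩)

theorem symm {a b : Γ} (h : Sim Δ a b) : Sim Δ b a := by
  rcases h with ⟨h, rfl⟩ | h | h
  · exact Or.inl ⟨h, rfl⟩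
  · exact Or.inr (Or.inl h.symm)
  · exact Or.inr (Or.inr h.symm)

theorem eq_of_mem {a b : Γ} (h : Sim Δ a b) (ha : a ∈ Δ) : a = b := by
  rcases h with h | h | h
  · exact h.2
  · exact absurd ha h.1.1
  · exact absurd ha h.1.not_mem_of_neg

theorem mem_iff {a b : Γ} (h : Sim Δ a b) : a ∈ Δ ↔ b ∈ Δ :=
  ⟨fun ha => h.eq_of_mem ha ▸ ha, fun hb => h.symm.eq_of_mem hb ▸ hb⟩

theorem above {a b : Γ} (h : Sim Δ a b) (ha : Above Δ a) : Above Δ b := by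
  rcases h with h | h | h
  · exact absurd h.1 ha.1
  · exact h.2
  · exact absurd h.1 ha.not_above_neg

theorem neg {a b : Γ} (h : Sim Δ a b) : Sim Δ (-a) (-b) := by
  rcases h with ⟨h, rfl⟩ | h | h
  · exact refl _ _
  · exact Or.inr (Or.inr (by simpa using h))
  · exact Or.inr (Or.inl h)

theorem smul {a b : Γ} (h : Sim Δ a b) (q : ℚ) : Sim Δ (q • a) (q • b) := by
  have key : ∀ {r : ℚ}, 0 < r → Sim Δ (r • a) (r • b) := by
    intro r hr
    rcases h with ⟨h, rfl⟩ | h | h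
    · exact refl _ _
    · exact Or.inr (Or.inl ⟨h.1.smul hr, h.2.smul hr⟩)
    · refine Or.inr (Or.inr ?_)
      simpa only [smul_neg] using And.intro (h.1.smul hr) (h.2.smul hr)
  rcases lt_trichotomy q 0 with hq | rfl | hq
  · simpa using (key (neg_pos.2 hq)).neg
  · simpa using refl Δ 0
  · exact key hq

/-- Only a common shift in Δ is harmless: similarity is not preserved by adding arbitrary similar
pairs, so every needed combination of forms must be listed explicitly. -/
theorem add_mem (hΔ : IsConvex Δ) {a b δ : Γ} (h : Sim Δ a b) (hδ : δ ∈ Δ) :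
    Sim Δ (a + δ) (b + δ) := by
  rcases h with ⟨h, rfl⟩ | h | h
  · exact refl _ _
  · exact Or.inr (Or.inl ⟨h.1.add_mem hΔ hδ, h.2.add_mem hΔ hδ⟩)
  · refine Or.inr (Or.inr ?_)
    simpa only [neg_add] using
      And.intro (h.1.add_mem hΔ (Δ.neg_mem hδ)) (h.2.add_mem hΔ (Δ.neg_mem hδ))

theorem eq_zero_iff {a b : Γ} (h : Sim Δ a b) : a = 0 ↔ b = 0 := by
  constructor
  · rintro rfl
    exact (h.eq_of_mem Δ.zero_mem).symm
  · rintro rfl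
    exact (h.symm.eq_of_mem Δ.zero_mem).symm

theorem pos_iff {a b : Γ} (h : Sim Δ a b) : 0 < a ↔ 0 < b := by
  rcases h with ⟨h, rfl⟩ | h | h
  · rfl
  · exact iff_of_true h.1.2 h.2.2
  · exact iff_of_false (neg_pos.1 h.1.2).not_gt (neg_pos.1 h.2.2).not_gt

end Sim

/-- This is density without endpoints modulo Δ. Between the largest lower bound and the smallest
upper bound take the midpoint: half of an element outside Δ is still outside Δ. If one side is
empty, step away by e. -/
theorem exists_between_finite (hΔ : IsConvex Δ) {e : Γ} (he : Above Δ e) {s t : Set Γ}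
    (hs : s.Finite) (ht : t.Finite) (hst : ∀ a ∈ s, ∀ b ∈ t, Above Δ (b - a)) :
    ∃ x, (∀ a ∈ s, Above Δ (x - a)) ∧ ∀ b ∈ t, Above Δ (b - x) := by
  have key : ∀ m, (∀ a ∈ s, a ≤ m) → (∀ b ∈ t, Above Δ (b - m)) →
      ∃ x, (∀ a ∈ s, Above Δ (x - a)) ∧ ∀ b ∈ t, Above Δ (b - x) := by
    intro m hm hmt
    rcases t.eq_empty_or_nonempty with rfl | hne
    · exact ⟨m + e, fun a ha => he.mono hΔ (by
        have := hm a ha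
        rw [add_sub_right_comm]
        exact le_add_of_nonneg_left (sub_nonneg.2 this)), by simp⟩
    · obtain ⟨u, hu, hmin⟩ := Set.exists_min_image t id ht hne
      have hum := (hmt u hu).smul (q := 1 / 2) (by norm_num)
      refine ⟨m + (1 / 2 : ℚ) • (u - m), fun a ha => hum.mono hΔ ?_, fun b hb => hum.mono hΔ ?_⟩
      · rw [add_sub_right_comm]
        exact le_add_of_nonneg_left (sub_nonneg.2 (hm a ha))
      · have h1 : (1 / 2 : ℚ) • (u - m) = u - (m + (1 / 2 : ℚ) • (u - m)) := by module
        conv_lhs => rw [h1]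
        exact sub_le_sub_right (hmin b hb) _
  rcases s.eq_empty_or_nonempty with rfl | hne
  · rcases t.eq_empty_or_nonempty with rfl | hne
    · exact ⟨0, by simp, by simp⟩
    · obtain ⟨u, hu, hmin⟩ := Set.exists_min_image t id ht hne
      refine key (u - e) (by simp) fun b hb => he.mono hΔ ?_
      have h1 : e = u - (u - e) := by abel
      conv_lhs => rw [h1]
      exact sub_le_sub_right (hmin b hb) _
  · obtain ⟨m, hm, hmax⟩ := Set.exists_max_image s id hs hne
    exact key m hmax fun b hb => hst m hm b hb

/-- Elimination of one variable: if the eliminants of two finite families of affine forms in one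
variable agree up to `Sim`, then each value of the variable in the first family is matched by a
value in the second one. -/
theorem exists_sim_affine (hΔ : IsConvex Δ) {e : Γ} (he : Above Δ e) {ι : Type*} [Finite ι]
    (q : ι → ℚ) (a b : ι → Γ)
    (hab : ∀ j k, Sim Δ (a j - (q j / q k) • a k) (b j - (q j / q k) • b k)) (x : Γ) :
    ∃ y, ∀ j, Sim Δ (a j + q j • x) (b j + q j • y) := by
  by_cases hex : ∃ k, q k ≠ 0 ∧ a k + q k • x ∈ Δ
  -- A form with value in Δ forces y: its two values must be equal. The other forms then differ from
  -- their eliminants by a common element of Δ.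
  · obtain ⟨k, hk, hmem⟩ := hex
    refine ⟨(q k)⁻¹ • (a k + q k • x - b k), fun j => ?_⟩
    have h1 := (hab j k).add_mem hΔ (Δ.smul_mem (q j / q k) hmem)
    convert h1 using 1
    · rw [smul_add, smul_smul, div_mul_cancel₀ _ hk]
      abel
    · rw [smul_smul, ← div_eq_mul_inv, smul_sub]
      abel
  -- Otherwise x is separated modulo Δ from the root of every form with nonzero slope. The roots `p`
  -- and `r` are ordered alike modulo Δ, so y can be put in the corresponding cut.
  · push Not at hex
    have hz : ∀ j, q j = 0 → Sim Δ (a j) (b j) := by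
      intro j hj
      -- Here 0 / 0 = 0 makes the eliminant of the pair (j, j) the form itself.
      simpa [hj] using hab j j
    let p : ι → Γ := fun j => -((q j)⁻¹ • a j)
    let r : ι → Γ := fun j => -((q j)⁻¹ • b j)
    have hp : ∀ j, q j ≠ 0 → ∀ z, q j • (z - p j) = a j + q j • z := by
      intro j hj z
      simp only [p, sub_neg_eq_add, smul_add, smul_smul, mul_inv_cancel₀ hj, one_smul]
      abel
    have hr : ∀ j, q j ≠ 0 → ∀ z, q j • (z - r j) = b j + q j • z := by
      intro j hj z
      simp only [r, sub_neg_eq_add, smul_add, smul_smul, mul_inv_cancel₀ hj, one_smul]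
      abel
    have hpr : ∀ j k, q j ≠ 0 → q k ≠ 0 → Sim Δ (p k - p j) (r k - r j) := by
      intro j k hj hk
      convert (hab j k).smul (q j)⁻¹ using 1
      · simp only [p, smul_sub, smul_smul]
        rw [div_eq_mul_inv, ← mul_assoc, inv_mul_cancel₀ hj, one_mul]
        abel
      · simp only [r, smul_sub, smul_smul]
        rw [div_eq_mul_inv, ← mul_assoc, inv_mul_cancel₀ hj, one_mul]
        abel
    obtain ⟨y, hlo, hhi⟩ := exists_between_finite hΔ he
      (s := r '' {j | q j ≠ 0 ∧ Above Δ (x - p j)}) (t := r '' {j | q j ≠ 0 ∧ Above Δ (p j - x)})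
      (Set.toFinite _) (Set.toFinite _) (by
        rintro _ ⟨j, ⟨hj, hxj⟩, rfl⟩ _ ⟨k, ⟨hk, hxk⟩, rfl⟩
        refine (hpr j k hj hk).above (hxj.mono hΔ ?_)
        exact sub_le_sub_right (sub_nonneg.1 hxk.2.le) _)
    refine ⟨y, fun j => ?_⟩
    by_cases hj : q j = 0
    · simpa [hj] using hz j hj
    · rw [← hp j hj, ← hr j hj]
      refine Sim.smul ?_ _
      rcases mem_or_above Δ (x - p j) with h | h | h
      · exact absurd (hp j hj x ▸ Δ.smul_mem (q j) h) (hex j hj)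
      · exact Or.inr (Or.inl ⟨h, hlo _ ⟨j, ⟨hj, h⟩, rfl⟩⟩)
      · refine Or.inr (Or.inr ⟨h, ?_⟩)
        rw [neg_sub] at h ⊢
        exact hhi _ ⟨j, ⟨hj, h⟩, rfl⟩

end ConvexSubspace

/-! ### The subspace Δ and the behaviour of ψ, s, p away from it -/

section SmallElements

variable {Γ : Type*} [AddCommGroup Γ] [LinearOrder Γ] [IsOrderedAddMonoid Γ]
  {ψ : {a : Γ // a ≠ 0} → Γ}

theorem psi_ratMul (h : IsTLogModel ψ) (q : ℚ) (a : Γ) (ha : a ≠ 0) (hqa : ratMul h q a ≠ 0) :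
    ψ ⟨ratMul h q a, hqa⟩ = ψ ⟨a, ha⟩ := by
  have h1 : (q.den : ℤ) • ratMul h q a = q.num • a := by
    rw [natCast_zsmul, den_nsmul_ratMul]
  have hden : (q.den : ℤ) ≠ 0 := by exact_mod_cast q.den_ne_zero
  have hnum : q.num ≠ 0 := by
    intro h0
    rw [h0, zero_smul] at h1
    exact smul_ne_zero hden hqa h1
  rw [← h.ac2 _ hqa _ hden, ← h.ac2 _ ha _ hnum]
  simp only [h1]

theorem psi_neg (h : IsTLogModel ψ) {a : Γ} (ha : a ≠ 0) (hna : -a ≠ 0) :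
    ψ ⟨-a, hna⟩ = ψ ⟨a, ha⟩ := by
  rw [← h.ac2 a ha (-1) (by norm_num)]
  simp only [neg_smul, one_smul]

/-- The convex subspace of all `a` with `a = 0` or `ψ(a) > s(0)`. -/
def smallElements (h : IsTLogModel ψ) : letI := ratModule h; Submodule ℚ Γ :=
  letI := ratModule h
  { carrier := {a | ∀ ha : a ≠ 0, s h.integration 0 < ψ ⟨a, ha⟩}
    zero_mem' := fun ha => absurd rfl ha
    add_mem' := by
      intro a b ha hb hab
      by_cases ha0 : a = 0
      · subst ha0
        simpa using hb (by simpa using hab)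
      by_cases hb0 : b = 0
      · subst hb0
        simpa using ha (by simpa using hab)
      exact (lt_min (ha ha0) (hb hb0)).trans_le (h.ac1 a b ha0 hb0 hab)
    smul_mem' := by
      intro q a ha hqa
      have ha0 : a ≠ 0 := by
        rintro rfl
        exact hqa (smul_zero q)
      have h1 := psi_ratMul h q a ha0 hqa
      exact (ha ha0).trans_eq h1.symm }

theorem mem_smallElements (h : IsTLogModel ψ) {a : Γ} :
    (letI := ratModule h; a ∈ smallElements h) ↔ ∀ ha : a ≠ 0, s h.integration 0 < ψ ⟨a, ha⟩ :=
  Iff.rfl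

theorem isConvex_smallElements (h : IsTLogModel ψ) :
    letI := ratModule h; IsConvex (smallElements h) := by
  intro a b ha hab hb
  rw [mem_smallElements] at hb ⊢
  intro ha0
  have hpos := ha.lt_of_ne' ha0
  exact (hb (hpos.trans_le hab).ne').trans_le (h.hc a b hpos hab)

theorem s_zero_le (h : IsTLogModel ψ) (a : {a : Γ // a ≠ 0}) : s h.integration 0 ≤ ψ a :=
  h.s_zero_least.2 ⟨a, rfl⟩

theorem psi_eq_s_zero (h : IsTLogModel ψ) {a : Γ} (ha : a ≠ 0)
    (hs : letI := ratModule h; a ∉ smallElements h) : ψ ⟨a, ha⟩ = s h.integration 0 := by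
  rw [mem_smallElements] at hs
  push Not at hs
  obtain ⟨_, h2⟩ := hs
  exact le_antisymm h2 (s_zero_le h _)

/-- The integral γ of 0 satisfies γ + s(0) = 0, so γ = -s(0), and ψ is even. -/
theorem psi_s_zero (h : IsTLogModel ψ) :
    ψ ⟨s h.integration 0, h.s_zero_pos.ne'⟩ = s h.integration 0 := by
  have h1 := der_integral h.integration 0
  rw [der] at h1
  have h2 : (integral h.integration 0).1 = -s h.integration 0 := eq_neg_of_add_eq_zero_left h1
  have h3 : integral h.integration 0
      = ⟨-s h.integration 0, neg_ne_zero.2 h.s_zero_pos.ne'⟩ := Subtype.ext h2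
  rw [← psi_neg h h.s_zero_pos.ne' (neg_ne_zero.2 h.s_zero_pos.ne'), ← h3]
  rfl

theorem above_s_zero (h : IsTLogModel ψ) :
    letI := ratModule h; Above (smallElements h) (s h.integration 0) :=
  ⟨fun hs => (hs h.s_zero_pos.ne').ne' (psi_s_zero h), h.s_zero_pos⟩

/-- If d = ψ(a) - s(0) were positive with ψ(d) = s(0), the axiom `ac3` would give ψ(a) < d + ψ(d) =
ψ(a). -/
theorem psi_sub_s_zero_mem (h : IsTLogModel ψ) (a : {a : Γ // a ≠ 0}) :
    letI := ratModule h; ψ a - s h.integration 0 ∈ smallElements h := by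
  rw [mem_smallElements]
  intro hne
  refine (s_zero_le h _).lt_of_ne fun heq => ?_
  have hpos : 0 < ψ a - s h.integration 0 := (sub_nonneg.2 (s_zero_le h a)).lt_of_ne' hne
  have h1 := h.ac3 _ a.1 hpos a.2
  rw [← heq, sub_add_cancel] at h1
  exact lt_irrefl _ h1

/-- Write a = γ + ψ(γ). As ψ(γ) is in s(0) + Δ, the integral γ is outside Δ, where ψ is constant. -/
theorem s_eq_s_zero (h : IsTLogModel ψ) {a : Γ}
    (ha : letI := ratModule h; a - s h.integration 0 ∉ smallElements h) :
    s h.integration a = s h.integration 0 := by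
  letI := ratModule h
  have h1 := der_integral h.integration a
  rw [der] at h1
  refine psi_eq_s_zero h (integral h.integration a).2 fun hmem => ha ?_
  have h2 := psi_sub_s_zero_mem h (integral h.integration a)
  rw [← h1, add_sub_assoc]
  exact Submodule.add_mem _ hmem h2

theorem psiTop_eq_top_or (ψ : {a : Γ // a ≠ 0} → Γ) (a : Γ) :
    psiTop ψ a = ⊤ ∨ ∃ b, psiTop ψ a = ((ψ b : Γ) : WithTop Γ) := by
  unfold psiTop
  split_ifs with ha
  · exact Or.inr ⟨_, rfl⟩
  · exact Or.inl rfl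

theorem pTop_eq_top_or (h : IsTLogModel ψ) (a : Γ) :
    pTop h a = ⊤ ∨ ∃ b, pTop h a = ((ψ b : Γ) : WithTop Γ) := by
  unfold pTop
  split_ifs with ha
  · obtain ⟨b, hb⟩ := Function.invFunOn_mem (h.s_bijOn.surjOn ha)
    exact Or.inr ⟨b, by rw [hb]⟩
  · exact Or.inl rfl

theorem pTop_eq_top (h : IsTLogModel ψ) {a : Γ}
    (ha : letI := ratModule h; a - s h.integration 0 ∉ smallElements h) : pTop h a = ⊤ := by
  rw [pTop, if_neg]
  rintro ⟨⟨b, rfl⟩, _⟩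
  exact ha (psi_sub_s_zero_mem h b)

theorem divNat_eq_smul (h : IsTLogModel ψ) (n : ℕ+) (a : Γ) :
    letI := ratModule h; divNat h n a = (1 / (n : ℕ) : ℚ) • a := by
  refine eq_ratMul h (m := 1) (n := (n : ℕ)) (by exact_mod_cast n.ne_zero) ?_ ?_
  · have : ((n : ℕ) : ℚ) ≠ 0 := by exact_mod_cast n.ne_zero
    push_cast
    field_simp
  · rw [natCast_zsmul, nsmul_divNat, one_smul]

end SmallElements

/-! ### Affine forms in free and bound variables -/

section AffineForms

variable {Γ : Type*} [AddCommGroup Γ] [Module ℚ Γ]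

/-- Affine forms over `ℚ` with constant term in `Γ`, in `k` free and `n` bound variables. -/
abbrev AffineForm (Γ : Type*) (k n : ℕ) : Type _ := (Fin k → ℚ) × (Fin n → ℚ) × Γ

/-- The value of an affine form, where the variables equal to `∞` are replaced by `0`. -/
def AffineForm.eval {k n : ℕ} (f : AffineForm Γ k n) (v : Fin k → WithTop Γ)
    (x : Fin n → WithTop Γ) : Γ :=
  ∑ i, f.1 i • (v i).untopD 0 + ∑ j, f.2.1 j • (x j).untopD 0 + f.2.2

namespace AffineForm

variable {k n : ℕ} (f g : AffineForm Γ k n) (v : Fin k → WithTop Γ) (x : Fin n → WithTop Γ)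

theorem eval_add : eval (f + g) v x = eval f v x + eval g v x := by
  simp only [eval, Prod.fst_add, Prod.snd_add, Pi.add_apply, add_smul, Finset.sum_add_distrib]
  abel

theorem eval_smul (q : ℚ) : eval (q • f) v x = q • eval f v x := by
  simp only [eval, Prod.smul_fst, Prod.smul_snd, Pi.smul_apply, smul_eq_mul, mul_smul, smul_add,
    Finset.smul_sum]

theorem eval_neg : eval (-f) v x = -eval f v x := by
  rw [← neg_one_smul ℚ, eval_smul, neg_one_smul]

theorem eval_sub : eval (f - g) v x = eval f v x - eval g v x := by
  rw [sub_eq_add_neg, eval_add, eval_neg, sub_eq_add_neg]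

/-- The constant form. -/
def const (k n : ℕ) (a : Γ) : AffineForm Γ k n := (0, 0, a)

theorem eval_const (a : Γ) : eval (const k n a) v x = a := by
  simp [eval, const]

/-- The coordinate form of a free variable. -/
def freeVar (Γ : Type*) [AddCommGroup Γ] (n : ℕ) {k : ℕ} (i : Fin k) : AffineForm Γ k n :=
  (Pi.single i 1, 0, 0)

theorem eval_freeVar (i : Fin k) : eval (freeVar Γ n i) v x = (v i).untopD 0 := by
  simp [eval, freeVar, Pi.single_apply]

/-- The coordinate form of a bound variable. -/
def boundVar (Γ : Type*) [AddCommGroup Γ] (k : ℕ) {n : ℕ} (j : Fin n) : AffineForm Γ k n :=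
  (0, Pi.single j 1, 0)

theorem eval_boundVar (j : Fin n) : eval (boundVar Γ k j) v x = (x j).untopD 0 := by
  simp [eval, boundVar, Pi.single_apply]

/-- The part of a form not involving the last bound variable. -/
def init {k n : ℕ} (f : AffineForm Γ k (n + 1)) : AffineForm Γ k n := (f.1, Fin.init f.2.1, f.2.2)

theorem eval_snoc (f : AffineForm Γ k (n + 1)) (z : WithTop Γ) :
    eval f v (Fin.snoc x z : Fin (n + 1) → WithTop Γ) =
      eval f.init v x + f.2.1 (Fin.last n) • z.untopD 0 := by
  simp only [eval, Fin.sum_univ_castSucc, Fin.snoc_castSucc, Fin.snoc_last, init, Fin.init]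
  abel

end AffineForm

end AffineForms

/-! ### Terms and formulas depend only on finitely many affine forms up to similarity -/

section Formulas

open FirstOrder Language

variable {Γ : Type*} [AddCommGroup Γ] [LinearOrder Γ] [IsOrderedAddMonoid Γ]
  {ψ : {a : Γ // a ≠ 0} → Γ} {k n : ℕ}

/-- Two tuples have the same infinite entries, and the affine forms in `F` take values at them
that agree up to `Sim`. -/
def TupleSim (h : IsTLogModel ψ) (F : Set (AffineForm Γ k n)) (v : Fin k → WithTop Γ)
    (x : Fin n → WithTop Γ) (w : Fin k → WithTop Γ) (y : Fin n → WithTop Γ) : Prop :=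
  letI := ratModule h
  (∀ i, v i = ⊤ ↔ w i = ⊤) ∧ (∀ j, x j = ⊤ ↔ y j = ⊤) ∧
    ∀ f ∈ F, Sim (smallElements h) (f.eval v x) (f.eval w y)

/-- The values `a`, `b` at two tuples are both infinite, or arise by adding the same small element
to the values of a common form in `G`. -/
def ValueSim (h : IsTLogModel ψ) (G : Set (AffineForm Γ k n)) (v : Fin k → WithTop Γ)
    (x : Fin n → WithTop Γ) (w : Fin k → WithTop Γ) (y : Fin n → WithTop Γ)
    (a b : WithTop Γ) : Prop :=
  letI := ratModule h
  (a = ⊤ ∧ b = ⊤) ∨ ∃ f ∈ G, ∃ δ ∈ smallElements h,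
    a = ((f.eval v x + δ : Γ) : WithTop Γ) ∧ b = ((f.eval w y + δ : Γ) : WithTop Γ)

variable {v w : Fin k → WithTop Γ} {x y : Fin n → WithTop Γ}

theorem TupleSim.mono {h : IsTLogModel ψ} {F F' : Set (AffineForm Γ k n)} (hF : F ⊆ F')
    (hs : TupleSim h F' v x w y) : TupleSim h F v x w y :=
  ⟨hs.1, hs.2.1, fun f hf => hs.2.2 f (hF hf)⟩

theorem TupleSim.symm {h : IsTLogModel ψ} {F : Set (AffineForm Γ k n)}
    (hs : TupleSim h F v x w y) : TupleSim h F w y v x :=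
  letI := ratModule h
  ⟨fun i => (hs.1 i).symm, fun j => (hs.2.1 j).symm, fun f hf => (hs.2.2 f hf).symm⟩

theorem ValueSim.add {h : IsTLogModel ψ} {G G' : Set (AffineForm Γ k n)} {a b a' b' : WithTop Γ}
    (hab : ValueSim h G v x w y a b) (hab' : ValueSim h G' v x w y a' b') :
    ValueSim h (Set.image2 (· + ·) G G') v x w y (a + a') (b + b') := by
  let := ratModule h
  rcases hab with ⟨rfl, rfl⟩ | ⟨f, hf, δ, hδ, rfl, rfl⟩
  · exact Or.inl ⟨rfl, rfl⟩
  rcases hab' with ⟨rfl, rfl⟩ | ⟨f', hf', δ', hδ', rfl, rfl⟩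
  · exact Or.inl ⟨rfl, rfl⟩
  refine Or.inr ⟨f + f', ⟨f, hf, f', hf', rfl⟩, δ + δ', Submodule.add_mem _ hδ hδ', ?_, ?_⟩
  · rw [← WithTop.coe_add, AffineForm.eval_add, add_add_add_comm]
  · rw [← WithTop.coe_add, AffineForm.eval_add, add_add_add_comm]

theorem ValueSim.smul {h : IsTLogModel ψ} {G : Set (AffineForm Γ k n)} {a b : WithTop Γ}
    (hab : ValueSim h G v x w y a b) (q : ℚ) :
    letI := ratModule h
    ValueSim h ((q • ·) '' G) v x w y (extendTop (fun z => ((q • z : Γ) : WithTop Γ)) a)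
      (extendTop (fun z => ((q • z : Γ) : WithTop Γ)) b) := by
  let := ratModule h
  rcases hab with ⟨rfl, rfl⟩ | ⟨f, hf, δ, hδ, rfl, rfl⟩
  · exact Or.inl ⟨rfl, rfl⟩
  refine Or.inr ⟨q • f, ⟨f, hf, rfl⟩, q • δ, Submodule.smul_mem _ _ hδ, ?_, ?_⟩
  · rw [AffineForm.eval_smul, ← smul_add]
    rfl
  · rw [AffineForm.eval_smul, ← smul_add]
    rfl

/-- Either the two arguments are equal, lying in e + Δ, or both are outside e + Δ, where g is
constant. So g takes exactly the same value at both, and a finite value is s(0) plus an element of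
Δ. This treats ψ, s and p at once. -/
theorem ValueSim.extendTop_of_far {h : IsTLogModel ψ} {F G : Set (AffineForm Γ k n)}
    {a b : WithTop Γ} {e : Γ} {g : Γ → WithTop Γ}
    (hfar : letI := ratModule h
      ∀ a b, a - e ∉ smallElements h → b - e ∉ smallElements h → g a = g b)
    (hrange : ∀ a, g a = ⊤ ∨ ∃ b, g a = ((ψ b : Γ) : WithTop Γ))
    (hF : (· - AffineForm.const k n e) '' G ⊆ F) (hs : TupleSim h F v x w y)
    (hab : ValueSim h G v x w y a b) :
    ValueSim h {AffineForm.const k n (s h.integration 0)} v x w y (extendTop g a)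
      (extendTop g b) := by
  let := ratModule h
  rcases hab with ⟨rfl, rfl⟩ | ⟨f, hf, δ, hδ, rfl, rfl⟩
  · exact Or.inl ⟨rfl, rfl⟩
  have h1 := (hs.2.2 _ (hF ⟨f, hf, rfl⟩)).add_mem (isConvex_smallElements h) hδ
  simp only [AffineForm.eval_sub, AffineForm.eval_const, sub_add_eq_add_sub] at h1
  have heq : g (f.eval v x + δ) = g (f.eval w y + δ) := by
    by_cases hm : f.eval v x + δ - e ∈ smallElements h
    · rw [sub_left_injective (h1.eq_of_mem hm)]
    · exact hfar _ _ hm (mt h1.mem_iff.2 hm)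
  change ValueSim h _ v x w y (g _) (g _)
  rw [← heq]
  rcases hrange (f.eval v x + δ) with ht | ⟨c, hc⟩
  · exact Or.inl ⟨ht, ht⟩
  · refine Or.inr ⟨_, rfl, _, psi_sub_s_zero_mem h c, ?_, ?_⟩ <;>
      rw [hc, AffineForm.eval_const, add_sub_cancel]

/-- By induction on the term. The sets of forms depend on the term alone; the chosen form and the
small shift may vary with the pair of tuples, but are shared by both tuples of the pair. -/
theorem exists_valueSim_realize (h : IsTLogModel ψ) {A : Set (WithTop Γ)}
    (t : logLanguage.Term ((A ⊕ Fin k) ⊕ Fin n)) :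
    letI := logStructure h
    ∃ F G : Set (AffineForm Γ k n), F.Finite ∧ G.Finite ∧ ∀ v x w y, TupleSim h F v x w y →
      ValueSim h G v x w y (t.realize (Sum.elim (Sum.elim (↑) v) x))
        (t.realize (Sum.elim (Sum.elim (↑) w) y)) := by
  let := logStructure h
  let := ratModule h
  have hzero := Submodule.zero_mem (smallElements h)
  induction t with
  | var i =>
    rcases i with (⟨a, _⟩ | i) | j
    · refine ⟨∅, {AffineForm.const k n (a.untopD 0)}, Set.finite_empty, Set.finite_singleton _, ?_⟩
      intro v x w y _
      by_cases ha : a = ⊤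
      · exact Or.inl ⟨ha, ha⟩
      · lift a to Γ using ha
        refine Or.inr ⟨_, rfl, 0, hzero, ?_, ?_⟩ <;> simp [AffineForm.eval_const]
    · refine ⟨∅, {AffineForm.freeVar Γ n i}, Set.finite_empty, Set.finite_singleton _, ?_⟩
      intro v x w y hs
      simp only [Term.realize_var, Sum.elim_inl, Sum.elim_inr]
      by_cases hv : v i = ⊤
      · exact Or.inl ⟨hv, (hs.1 i).1 hv⟩
      · have hw := mt (hs.1 i).2 hv
        refine Or.inr ⟨_, rfl, 0, hzero, ?_, ?_⟩
        · rw [AffineForm.eval_freeVar]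
          lift v i to Γ using hv with z
          simp
        · rw [AffineForm.eval_freeVar]
          lift w i to Γ using hw with z
          simp
    · refine ⟨∅, {AffineForm.boundVar Γ k j}, Set.finite_empty, Set.finite_singleton _, ?_⟩
      intro v x w y hs
      simp only [Term.realize_var, Sum.elim_inr]
      by_cases hx : x j = ⊤
      · exact Or.inl ⟨hx, (hs.2.1 j).1 hx⟩
      · have hy := mt (hs.2.1 j).2 hx
        refine Or.inr ⟨_, rfl, 0, hzero, ?_, ?_⟩
        · rw [AffineForm.eval_boundVar]
          lift x j to Γ using hx with z
          simp
        · rw [AffineForm.eval_boundVar]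
          lift y j to Γ using hy with z
          simp
  | func f ts ih =>
    simp only [Term.realize_func]
    change LogFunc _ at f
    cases f with
    | zero =>
      refine ⟨∅, {0}, Set.finite_empty, Set.finite_singleton _, fun v x w y _ => ?_⟩
      refine Or.inr ⟨0, rfl, 0, hzero, ?_, ?_⟩ <;>
      · simp [AffineForm.eval]
        rfl
    | infty => exact ⟨∅, ∅, Set.finite_empty, Set.finite_empty, fun v x w y _ => Or.inl ⟨rfl, rfl⟩⟩
    | add =>
      obtain ⟨F, G, hF, hG, hs⟩ := ih 0
      obtain ⟨F', G', hF', hG', hs'⟩ := ih 1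
      exact ⟨F ∪ F', Set.image2 (· + ·) G G', hF.union hF', hG.image2 _ hG',
        fun v x w y hvw => (hs v x w y (hvw.mono Set.subset_union_left)).add
          (hs' v x w y (hvw.mono Set.subset_union_right))⟩
    | neg =>
      obtain ⟨F, G, hF, hG, hs⟩ := ih 0
      refine ⟨F, ((-1 : ℚ) • ·) '' G, hF, hG.image _, fun v x w y hvw => ?_⟩
      convert (hs v x w y hvw).smul (-1) using 1 <;>
      · simp only [neg_smul, one_smul]
        rfl
    | psi =>
      obtain ⟨F, G, hF, hG, hs⟩ := ih 0
      refine ⟨F ∪ (· - AffineForm.const k n 0) '' G, _, hF.union (hG.image _),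
        Set.finite_singleton _, fun v x w y hvw => ValueSim.extendTop_of_far ?_
          (psiTop_eq_top_or ψ) Set.subset_union_right hvw
          (hs v x w y (hvw.mono Set.subset_union_left))⟩
      have key : ∀ a, a ∉ smallElements h → psiTop ψ a = (s h.integration 0 : Γ) := by
        intro a ha
        have ha0 : a ≠ 0 := fun h0 => ha (h0 ▸ hzero)
        rw [psiTop, dif_pos ha0, psi_eq_s_zero h ha0 ha]
      intro a b ha hb
      rw [sub_zero] at ha hb
      rw [key a ha, key b hb]
    | succ =>
      obtain ⟨F, G, hF, hG, hs⟩ := ih 0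
      refine ⟨F ∪ (· - AffineForm.const k n (s h.integration 0)) '' G, _, hF.union (hG.image _),
        Set.finite_singleton _, fun v x w y hvw => ValueSim.extendTop_of_far ?_
          (fun a => Or.inr ⟨_, rfl⟩) Set.subset_union_right hvw
          (hs v x w y (hvw.mono Set.subset_union_left))⟩
      intro a b ha hb
      rw [s_eq_s_zero h ha, s_eq_s_zero h hb]
    | pred =>
      obtain ⟨F, G, hF, hG, hs⟩ := ih 0
      refine ⟨F ∪ (· - AffineForm.const k n (s h.integration 0)) '' G, _, hF.union (hG.image _),
        Set.finite_singleton _, fun v x w y hvw => ValueSim.extendTop_of_far ?_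
          (pTop_eq_top_or h) Set.subset_union_right hvw
          (hs v x w y (hvw.mono Set.subset_union_left))⟩
      intro a b ha hb
      rw [pTop_eq_top h ha, pTop_eq_top h hb]
    | div m =>
      obtain ⟨F, G, hF, hG, hs⟩ := ih 0
      refine ⟨F, ((1 / (m : ℕ) : ℚ) • ·) '' G, hF, hG.image _, fun v x w y hvw => ?_⟩
      convert (hs v x w y hvw).smul (1 / (m : ℕ) : ℚ) using 1 <;>
      · simp only [← divNat_eq_smul h]
        rfl

/-- Comparing two values means finding the sign of a difference of forms, up to a common shift in Δ,
and similarity preserves this sign. -/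
theorem ValueSim.sub_cases {h : IsTLogModel ψ} {F G G' : Set (AffineForm Γ k n)}
    {a b a' b' : WithTop Γ} (hF : Set.image2 (· - ·) G' G ⊆ F) (hs : TupleSim h F v x w y)
    (hab : ValueSim h G v x w y a b) (hab' : ValueSim h G' v x w y a' b') :
    (a = a' ↔ b = b') ∧ (a < a' ↔ b < b') := by
  let := ratModule h
  rcases hab with ⟨rfl, rfl⟩ | ⟨f, hf, δ, hδ, rfl, rfl⟩ <;>
  rcases hab' with ⟨rfl, rfl⟩ | ⟨f', hf', δ', hδ', rfl, rfl⟩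
  · simp
  · exact ⟨iff_of_false WithTop.top_ne_coe WithTop.top_ne_coe, iff_of_false not_top_lt not_top_lt⟩
  · exact ⟨iff_of_false WithTop.coe_ne_top WithTop.coe_ne_top,
      iff_of_true (WithTop.coe_lt_top _) (WithTop.coe_lt_top _)⟩
  · have h1 := (hs.2.2 _ (hF ⟨f', hf', f, hf, rfl⟩)).add_mem (isConvex_smallElements h)
      (Submodule.sub_mem _ hδ' hδ)
    simp only [AffineForm.eval_sub, sub_add_sub_comm] at h1
    have h2 := h1.eq_zero_iff
    have h3 := h1.pos_iff
    rw [sub_eq_zero, sub_eq_zero] at h2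
    rw [sub_pos, sub_pos] at h3
    simp only [WithTop.coe_inj, WithTop.coe_lt_coe]
    exact ⟨by rw [eq_comm, h2, eq_comm], h3⟩

theorem exists_tupleSim_snoc (h : IsTLogModel ψ) {F : Set (AffineForm Γ k (n + 1))}
    (hF : F.Finite) : ∃ F' : Set (AffineForm Γ k n), F'.Finite ∧ ∀ v x w y,
      TupleSim h F' v x w y → ∀ z : WithTop Γ, ∃ z' : WithTop Γ,
        TupleSim h F v (Fin.snoc x z : Fin (n + 1) → WithTop Γ) w
          (Fin.snoc y z' : Fin (n + 1) → WithTop Γ) := by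
  let := ratModule h
  -- The truncated forms serve z = ∞, which evaluation reads as 0; the eliminants serve finite z.
  refine ⟨AffineForm.init '' F ∪ Set.image2 (fun f g => f.init -
    (f.2.1 (Fin.last n) / g.2.1 (Fin.last n)) • g.init) F F,
    (hF.image _).union (hF.image2 _ hF), fun v x w y hs z => ?_⟩
  by_cases hz : z = ⊤
  · subst hz
    refine ⟨⊤, hs.1, fun j => ?_, fun f hf => ?_⟩
    · refine Fin.lastCases ?_ (fun i => ?_) j
      · simp
      · simpa using hs.2.1 i
    · simpa [AffineForm.eval_snoc] using hs.2.2 _ (Or.inl ⟨f, hf, rfl⟩)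
  · lift z to Γ using hz
    have := hF.to_subtype
    obtain ⟨z', hz'⟩ := exists_sim_affine (isConvex_smallElements h) (above_s_zero h)
      (fun f : F => f.1.2.1 (Fin.last n)) (fun f => f.1.init.eval v x)
      (fun f => f.1.init.eval w y) (by
        intro f g
        simpa only [AffineForm.eval_sub, AffineForm.eval_smul] using
          hs.2.2 _ (Or.inr ⟨f, f.2, g, g.2, rfl⟩)) z
    refine ⟨z', hs.1, fun j => ?_, fun f hf => ?_⟩
    · refine Fin.lastCases ?_ (fun i => ?_) j
      · simp
      · simpa using hs.2.1 i
    · simpa [AffineForm.eval_snoc] using hz' ⟨f, hf⟩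

/-- Atomic formulas compare two terms; a quantifier is a back-and-forth step by
`exists_tupleSim_snoc`. One implication suffices, as similarity of tuples is symmetric. -/
theorem exists_tupleSim_realize (h : IsTLogModel ψ) {A : Set (WithTop Γ)}
    (φ : logLanguage.BoundedFormula (A ⊕ Fin k) n) :
    letI := logStructure h
    ∃ F : Set (AffineForm Γ k n), F.Finite ∧ ∀ v x w y, TupleSim h F v x w y →
      (φ.Realize (Sum.elim (↑) v) x ↔ φ.Realize (Sum.elim (↑) w) y) := by
  let := logStructure h
  induction φ with
  | falsum => exact ⟨∅, Set.finite_empty, fun v x w y _ => Iff.rfl⟩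
  | equal t t' =>
    obtain ⟨F, G, hF, hG, hs⟩ := exists_valueSim_realize h t
    obtain ⟨F', G', hF', hG', hs'⟩ := exists_valueSim_realize h t'
    refine ⟨F ∪ (F' ∪ Set.image2 (· - ·) G' G), hF.union (hF'.union (hG'.image2 _ hG)),
      fun v x w y hvw => ?_⟩
    exact (ValueSim.sub_cases (fun f hf => Or.inr (Or.inr hf)) hvw
      (hs v x w y (hvw.mono fun f hf => Or.inl hf))
      (hs' v x w y (hvw.mono fun f hf => Or.inr (Or.inl hf)))).1
  | rel R ts =>
    change LogRel _ at R
    cases R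
    obtain ⟨F, G, hF, hG, hs⟩ := exists_valueSim_realize h (ts 0)
    obtain ⟨F', G', hF', hG', hs'⟩ := exists_valueSim_realize h (ts 1)
    refine ⟨F ∪ (F' ∪ Set.image2 (· - ·) G' G), hF.union (hF'.union (hG'.image2 _ hG)),
      fun v x w y hvw => ?_⟩
    exact (ValueSim.sub_cases (fun f hf => Or.inr (Or.inr hf)) hvw
      (hs v x w y (hvw.mono fun f hf => Or.inl hf))
      (hs' v x w y (hvw.mono fun f hf => Or.inr (Or.inl hf)))).2
  | imp φ φ' ih ih' =>
    obtain ⟨F, hF, hs⟩ := ih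
    obtain ⟨F', hF', hs'⟩ := ih'
    refine ⟨F ∪ F', hF.union hF', fun v x w y hvw => ?_⟩
    simp only [BoundedFormula.realize_imp]
    rw [hs v x w y (hvw.mono Set.subset_union_left), hs' v x w y (hvw.mono Set.subset_union_right)]
  | all φ ih =>
    obtain ⟨F, hF, hs⟩ := ih
    obtain ⟨F', hF', hs'⟩ := exists_tupleSim_snoc h hF
    have key : ∀ v x w y, TupleSim h F' v x w y → φ.all.Realize (Sum.elim (↑) v) x →
        φ.all.Realize (Sum.elim (↑) w) y := by
      intro v x w y hvw hall z
      obtain ⟨z', hz'⟩ := hs' w y v x hvw.symm z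
      exact (hs _ _ _ _ hz').2 (hall z')
    exact ⟨F', hF', fun v x w y hvw => ⟨key v x w y hvw, key w y v x hvw.symm⟩⟩

end Formulas

/-! ### Definable sets and functions at infinity -/

section AtInfinity

open FirstOrder Language

variable {Γ : Type*} [AddCommGroup Γ] [LinearOrder Γ] [IsOrderedAddMonoid Γ]

theorem exists_above_affine [Module ℚ Γ] {Δ : Submodule ℚ Γ} (hΔ : IsConvex Δ) {e : Γ}
    (he : Above Δ e) {q : ℚ} (hq : 0 < q) (b : Γ) : ∃ a, ∀ x, a < x → Above Δ (q • x + b) := by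
  refine ⟨q⁻¹ • (e - b), fun x hx => he.mono hΔ ?_⟩
  have h1 := rat_smul_pos hq (sub_pos.2 hx)
  rw [smul_sub, smul_smul, mul_inv_cancel₀ hq.ne', one_smul, sub_sub_eq_add_sub, sub_pos] at h1
  exact h1.le

theorem exists_forall_sim_affine [Module ℚ Γ] {Δ : Submodule ℚ Γ} (hΔ : IsConvex Δ) {e : Γ}
    (he : Above Δ e) {S : Set (ℚ × Γ)} (hS : S.Finite) :
    ∃ a, ∀ x, a < x → ∀ y, a < y → ∀ p ∈ S, Sim Δ (p.1 • x + p.2) (p.1 • y + p.2) := by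
  have key : ∀ p : ℚ × Γ, ∃ a, ∀ x, a < x → ∀ y, a < y →
      Sim Δ (p.1 • x + p.2) (p.1 • y + p.2) := by
    rintro ⟨q, b⟩
    rcases lt_trichotomy q 0 with hq | rfl | hq
    · obtain ⟨a, ha⟩ := exists_above_affine hΔ he (neg_pos.2 hq) (-b)
      refine ⟨a, fun x hx y hy => Or.inr (Or.inr ?_)⟩
      simpa only [neg_smul, ← neg_add] using And.intro (ha x hx) (ha y hy)
    · exact ⟨0, fun x _ y _ => by simpa using Sim.refl Δ b⟩
    · obtain ⟨a, ha⟩ := exists_above_affine hΔ he hq b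
      exact ⟨a, fun x hx y hy => Or.inr (Or.inl ⟨ha x hx, ha y hy⟩)⟩
  choose a ha using key
  obtain ⟨c, hc⟩ := (hS.image a).bddAbove
  exact ⟨c, fun x hx y hy p hp => ha p x ((hc ⟨p, hp, rfl⟩).trans_lt hx) y
    ((hc ⟨p, hp, rfl⟩).trans_lt hy)⟩

variable {ψ : {a : Γ // a ≠ 0} → Γ}

/-- Any b with ψ(b) = s(s(0)) works, since s(s(0)) > s(0). -/
theorem exists_ne_zero_mem_smallElements (h : IsTLogModel ψ) :
    ∃ δ : Γ, δ ≠ 0 ∧ letI := ratModule h; δ ∈ smallElements h := by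
  obtain ⟨⟨b, hb⟩, hlt, _⟩ := h.s_successor _ h.s_zero_least.1
  exact ⟨b.1, b.2, fun _ => hlt.trans_eq hb.symm⟩

theorem exists_Ioi_subset_or_inter_eq_empty (h : IsTLogModel ψ) {X : Set Γ}
    (hX : IsDefinableSet h X) : ∃ a : Γ, Set.Ioi a ⊆ X ∨ Set.Ioi a ∩ X = ∅ := by
  let := logStructure h
  let := ratModule h
  obtain ⟨φ, hφ⟩ := Set.definable_iff_exists_formula_sum.1 hX
  have hmem : ∀ x : Γ, x ∈ X ↔ BoundedFormula.Realize φ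
      (Sum.elim (↑) fun _ : Fin 1 => (x : WithTop Γ)) default := by
    intro x
    have h1 := Set.ext_iff.1 hφ fun _ => (x : WithTop Γ)
    simp only [Set.mem_ofPred_eq, Set.mem_image, WithTop.coe_inj, exists_eq_right] at h1
    rw [h1, Formula.Realize]
    exact iff_of_eq (congrArg _ (Subsingleton.elim _ _))
  obtain ⟨F, hF, hs⟩ := exists_tupleSim_realize h φ
  obtain ⟨a, ha⟩ := exists_forall_sim_affine (isConvex_smallElements h) (above_s_zero h)
    (hF.image fun f => (f.1 0, f.2.2))
  have hXa : ∀ x, a < x → ∀ y, a < y → x ∈ X → y ∈ X := by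
    intro x hx y hy hxX
    rw [hmem] at hxX ⊢
    refine (hs _ _ _ _ ⟨by simp, by simp, fun f hf => ?_⟩).1 hxX
    simpa [AffineForm.eval] using ha x hx y hy _ ⟨f, hf, rfl⟩
  refine ⟨a, ?_⟩
  by_cases hex : ∃ x, a < x ∧ x ∈ X
  · obtain ⟨x, hx, hxX⟩ := hex
    exact Or.inl fun y hy => hXa x hx y hy hxX
  · exact Or.inr (Set.eq_empty_iff_forall_notMem.2 fun x hx => hex ⟨x, hx.1, hx.2⟩)

theorem exists_tupleSim_pair (h : IsTLogModel ψ) {F : Set (AffineForm Γ 2 0)} (hF : F.Finite) :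
    ∃ a : Γ, ∀ x : Γ, a < x → ∀ y : Γ, a < y → ∀ z : WithTop Γ, ∃ z' : WithTop Γ,
      TupleSim h F ![(x : WithTop Γ), z] default ![(y : WithTop Γ), z'] default := by
  let := ratModule h
  -- Two kinds of forms in the first variable alone: the second variable is set to 0 for z = ∞, or
  -- eliminated for finite z.
  obtain ⟨a, ha⟩ := exists_forall_sim_affine (isConvex_smallElements h) (above_s_zero h)
    ((hF.image fun f => (f.1 0, f.2.2)).union (hF.image2 (fun f g =>
      (f.1 0 - f.1 1 / g.1 1 * g.1 0, f.2.2 - (f.1 1 / g.1 1) • g.2.2)) hF))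
  refine ⟨a, fun x hx y hy z => ?_⟩
  by_cases hz : z = ⊤
  · subst hz
    refine ⟨⊤, by simp [Fin.forall_fin_two], by simp, fun f hf => ?_⟩
    simpa [AffineForm.eval] using ha x hx y hy _ (Or.inl ⟨f, hf, rfl⟩)
  · lift z to Γ using hz
    have := hF.to_subtype
    obtain ⟨z', hz'⟩ := exists_sim_affine (isConvex_smallElements h) (above_s_zero h)
      (fun f : F => f.1.1 1) (fun f => f.1.1 0 • x + f.1.2.2) (fun f => f.1.1 0 • y + f.1.2.2) (by
        intro f g
        convert ha x hx y hy _ (Or.inr ⟨f, f.2, g, g.2, rfl⟩) using 1 <;> module) z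
    refine ⟨z', by simp [Fin.forall_fin_two], by simp, fun f hf => ?_⟩
    simpa [AffineForm.eval, add_right_comm] using hz' ⟨f, hf⟩

theorem exists_eq_affine (h : IsTLogModel ψ) {F : Γ → WithTop Γ} (hF : IsDefinableFun h F) :
    ∃ a : Γ, (∃ c : WithTop Γ, ∀ x : Γ, a < x → F x = c) ∨
      (∃ q : ℚ, q ≠ 0 ∧ ∃ β : Γ, ∀ x : Γ, a < x →
        F x = ((ratMul h q x + β : Γ) : WithTop Γ)) := by
  let := logStructure h
  let := ratModule h
  obtain ⟨φ, hφ⟩ := Set.definable_iff_exists_formula_sum.1 hF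
  have hmem : ∀ (x : Γ) (y : WithTop Γ), F x = y ↔ BoundedFormula.Realize φ
      (Sum.elim (↑) ![(x : WithTop Γ), y]) default := by
    intro x y
    have h1 := Set.ext_iff.1 hφ ![(x : WithTop Γ), y]
    simp only [Set.mem_ofPred_eq, Set.mem_range, Prod.mk.injEq, Matrix.cons_val_zero,
      Matrix.cons_val_one, WithTop.coe_inj, exists_eq_left] at h1
    rw [h1, Formula.Realize]
    exact iff_of_eq (congrArg _ (Subsingleton.elim _ _))
  obtain ⟨S, hS, hs⟩ := exists_tupleSim_realize h φ
  obtain ⟨a, ha⟩ := exists_tupleSim_pair h hS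
  have hsim : ∀ x : Γ, a < x → ∀ y : Γ, a < y →
      TupleSim h S ![(x : WithTop Γ), F x] default ![(y : WithTop Γ), F y] default := by
    intro x hx y hy
    obtain ⟨z', hz'⟩ := ha x hx y hy (F x)
    have h1 := (hs _ _ _ _ hz').1 ((hmem x _).1 rfl)
    -- The matching z' satisfies the formula for the graph together with y, so it is F y.
    rwa [(hmem y z').2 h1]
  have hx₀ : a < a + s h.integration 0 := lt_add_of_pos_right a h.s_zero_pos
  refine ⟨a, ?_⟩
  generalize a + s h.integration 0 = x₀ at hx₀
  have htop : ∀ x, a < x → (F x₀ = ⊤ ↔ F x = ⊤) := fun x hx => (hsim x₀ hx₀ x hx).1 1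
  by_cases hF₀ : F x₀ = ⊤
  · exact Or.inl ⟨⊤, fun x hx => (htop x hx).1 hF₀⟩
  obtain ⟨z, hz⟩ := WithTop.ne_top_iff_exists.1 hF₀
  -- If no form involving the second variable had a value in Δ, moving z by a nonzero δ in Δ would
  -- keep all values similar, so z + δ would also be a value of F at x₀.
  obtain ⟨f, hf, hf1, hfm⟩ : ∃ f ∈ S, f.1 1 ≠ 0 ∧
      f.1 0 • x₀ + f.1 1 • z + f.2.2 ∈ smallElements h := by
    by_contra! hcon
    obtain ⟨δ, hδ0, hδ⟩ := exists_ne_zero_mem_smallElements h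
    have h1 : TupleSim h S ![(x₀ : WithTop Γ), z] default
        ![(x₀ : WithTop Γ), ((z + δ : Γ) : WithTop Γ)] default := by
      refine ⟨?_, by simp, fun f hf => ?_⟩
      · rw [Fin.forall_fin_two]
        exact ⟨Iff.rfl, iff_of_false WithTop.coe_ne_top WithTop.coe_ne_top⟩
      · have h2 : f.eval ![(x₀ : WithTop Γ), z] default = f.1 0 • x₀ + f.1 1 • z + f.2.2 := by
          simp [AffineForm.eval]
        have h3 : f.eval ![(x₀ : WithTop Γ), ((z + δ : Γ) : WithTop Γ)] default =
            f.1 0 • x₀ + f.1 1 • z + f.2.2 + f.1 1 • δ := by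
          simp only [AffineForm.eval, Fin.sum_univ_two, Finset.univ_eq_empty, Finset.sum_empty,
            Matrix.cons_val_zero, Matrix.cons_val_one, WithTop.untopD_coe]
          module
        rw [h2, h3]
        by_cases hf1 : f.1 1 = 0
        · rw [hf1, zero_smul ℚ δ, add_zero]
          exact Sim.refl _ _
        · have hnot := hcon f hf hf1
          have hδ' := Submodule.smul_mem _ (f.1 1) hδ
          rcases mem_or_above (smallElements h) (f.1 0 • x₀ + f.1 1 • z + f.2.2) with hm | hm | hm
          · exact absurd hm hnot
          · exact Or.inr (Or.inl ⟨hm, hm.add_mem (isConvex_smallElements h) hδ'⟩)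
          · refine Or.inr (Or.inr ⟨hm, ?_⟩)
            rw [neg_add]
            exact hm.add_mem (isConvex_smallElements h) (Submodule.neg_mem _ hδ')
    have h2 := (hmem _ _).2 ((hs _ _ _ _ h1).1 ((hmem _ _).1 hz.symm))
    rw [← hz, WithTop.coe_inj, left_eq_add] at h2
    exact hδ0 h2
  -- The value of f at (x, F x) will equal that at (x₀, z), because the latter lies in Δ. Solving
  -- for F x gives this constant; the constant term of f cancels.
  set β : Γ := (f.1 1)⁻¹ • (f.1 0 • x₀ + f.1 1 • z)
  have hlin : ∀ x, a < x → F x = ((-((f.1 1)⁻¹ * f.1 0) • x + β : Γ) : WithTop Γ) := by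
    intro x hx
    obtain ⟨y, hy⟩ := WithTop.ne_top_iff_exists.1 (mt (htop x hx).2 hF₀)
    have h1 := (hsim x₀ hx₀ x hx).2.2 f hf
    rw [← hy, ← hz] at h1
    simp only [AffineForm.eval, Fin.sum_univ_two, Finset.univ_eq_empty, Finset.sum_empty,
      Matrix.cons_val_zero, Matrix.cons_val_one, WithTop.untopD_coe, add_zero] at h1
    have h2 := add_left_injective _ (h1.eq_of_mem hfm)
    rw [← hy, WithTop.coe_inj]
    simp only [β]
    rw [h2, smul_add, smul_smul, smul_smul, inv_mul_cancel₀ hf1]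
    module
  by_cases hq : f.1 0 = 0
  · refine Or.inl ⟨(β : Γ), fun x hx => ?_⟩
    rw [hlin x hx, hq, mul_zero, neg_zero, zero_smul, zero_add]
  · exact Or.inr ⟨_, neg_ne_zero.2 (mul_ne_zero (inv_ne_zero hf1) hq), β, hlin⟩

end AtInfinity

end AsymptoticCouple

theorem mainTheorem10 {Γ : Type*} [AddCommGroup Γ] [LinearOrder Γ] [IsOrderedAddMonoid Γ]
    {ψ : {a : Γ // a ≠ 0} → Γ} (h : AsymptoticCouple.IsTLogModel ψ) :
    (∀ X : Set Γ, AsymptoticCouple.IsDefinableSet h X →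
      ∃ a : Γ, Set.Ioi a ⊆ X ∨ Set.Ioi a ∩ X = ∅) ∧
    (∀ F : Γ → WithTop Γ, AsymptoticCouple.IsDefinableFun h F →
      ∃ a : Γ,
        (∃ c : WithTop Γ, ∀ x : Γ, a < x → F x = c) ∨
        (∃ q : ℚ, q ≠ 0 ∧ ∃ β : Γ, ∀ x : Γ, a < x →
          F x = ((AsymptoticCouple.ratMul h q x + β : Γ) : WithTop Γ))) :=
  ⟨fun _ hX => AsymptoticCouple.exists_Ioi_subset_or_inter_eq_empty h hX,
    fun _ hF => AsymptoticCouple.exists_eq_affine h hF⟩
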